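/- There are absolute constants $c, C > 0$ and $k \in \mathbb{N}$ such that the following holds. Let $\Omega$ be a non-empty finite set, let $0 < c_1 \le 1$, $0 < \varepsilon_2 \le 1$, put $\ell = \lfloor \log_2 \frac{|\Omega|}{c_1 \varepsilon_2} \rfloor + 1$, and let $0 \le \varepsilon_1 \le c\,\varepsilon_2/\ell$. Then there is a randomized algorithm with sampling access to an unknown probability distribution $P$ on $\Omega$, and with sampling and exact evaluation access to a reference probability distribution $P^*$ on $\Omega$ (that is, it may adaptively draw independent samples from $P$ and from $P^*$, and query $P^*(x)$ for any $x \in \Omega$), which draws in total, from $P$ and $P^*$ together, at most \[ C\left(1+\log\frac{|\Omega|}{\varepsilon_2}\right)^{k}\left(|\Omega|\left(\frac{\varepsilon_1}{\varepsilon_2^2}\right)^2+|\Omega|\,\frac{\varepsilon_1}{\varepsilon_2^2}+\frac{\sqrt{|\Omega|}}{\varepsilon_2^2}\right) \] samples, that is, $\widetilde{O}\big(|\Omega|(\varepsilon_1/\varepsilon_2^2)^2+|\Omega|(\varepsilon_1/\varepsilon_2^2)+\sqrt{|\Omega|}/\varepsilon_2^2\big)$ samples, and such that for every $P^*$ with $\|P^*\|_2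 \le \sqrt{2/|\Omega|}$ and every $P$: if $\|P-P^*\|_1 \le \varepsilon_1$, it accepts with probability at least $4/5$; and if $\|P-P^*\|_1 \ge \varepsilon_2$, it rejects with probability at least $4/5$. Here $\|P-P^*\|_1=\sum_{x\in\Omega}|P(x)-P^*(x)|$ and $\|P^*\|_2=\big(\sum_{x\in\Omega}P^*(x)^2\big)^{1/2}$. -/

import Mathlib

universe u

namespace DistributionTesting

/-- The `ℓ₁` distance `∑ₓ |P(x) - Q(x)|` between two distributions on a finite domain. -/
noncomputable def l1Dist {Ω : Type u} [Fintype Ω] (P Q : PMF Ω) : ℝ :=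
  ∑ x, |(P x).toReal - (Q x).toReal|

/-- The `ℓ₂` norm of the probability mass function of a distribution on a finite domain. -/
noncomputable def l2Norm {Ω : Type u} [Fintype Ω] (P : PMF Ω) : ℝ :=
  Real.sqrt (∑ x, (P x).toReal ^ 2)

/-- The number of buckets `⌊log₂ (N / (c₁ ε₂))⌋ + 1` for a domain with `N` elements. It is used
with `0 < c₁ ≤ 1` and `0 < ε₂ ≤ 1`, where the logarithm is nonnegative for `N ≥ 1`. -/
noncomputable def numBuckets (c₁ : ℝ) (N : ℕ) (ε₂ : ℝ) : ℕ :=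
  ⌊Real.logb 2 ((N : ℝ) / (c₁ * ε₂))⌋₊ + 1

/-- Adaptive randomized testing algorithms over the domain `Ω`, as decision trees. At each step
the algorithm stops and answers (`true` is accept, `false` is reject), or draws a fresh sample
from the unknown distribution, or draws a fresh sample from the reference distribution, or
evaluates the reference distribution at a point of its choice, or uses internal randomness.
The tree itself depends neither on the unknown nor on the reference distribution. -/
inductive Tester (Ω : Type u) : Type u
  | answer (b : Bool) : Tester Ω
  | sampUnknown (next : Ω → Tester Ω) : Tester Ω
  | sampRef (next : Ω → Tester Ω) : Tester Ω
  | evalRef (x : Ω) (next : ℝ → Tester Ω) : Tester Ω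
  | random (μ : PMF ℕ) (next : ℕ → Tester Ω) : Tester Ω

namespace Tester

/-- The distribution of the answer when the unknown distribution is `P` and the reference
distribution is `Pref`. All samples are independent. -/
noncomputable def run {Ω : Type u} (P Pref : PMF Ω) : Tester Ω → PMF Bool
  | answer b => PMF.pure b
  | sampUnknown next => P.bind fun x => run P Pref (next x)
  | sampRef next => Pref.bind fun x => run P Pref (next x)
  | evalRef x next => run P Pref (next (Pref x).toReal)
  | random μ next => μ.bind fun i => run P Pref (next i)

/-- The worst-case total number of samples drawn, from the unknown and from the reference
distribution together, over all possible samples, oracle answers and internal random values. -/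
noncomputable def sampleCount {Ω : Type u} : Tester Ω → ℕ∞
  | answer _ => 0
  | sampUnknown next => 1 + ⨆ x, sampleCount (next x)
  | sampRef next => 1 + ⨆ x, sampleCount (next x)
  | evalRef _ next => ⨆ r, sampleCount (next r)
  | random _ next => ⨆ i, sampleCount (next i)

end Tester

end DistributionTesting

/-!
The reference distribution `q` can be read off completely, since evaluations cost no samples, so
the task is to test the identity of the unknown `p` with a known `q`, with tolerance `ε₁`. Let
`N = |Ω|` and `δ = p - q`, and give the point `x` the weight `w x = q x + 1 / N`, of total mass `2`.

Were every `|δ x|` at most `T * w x`, the `χ²`-type distance `D = ∑ δ² / w` would decide: by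
Cauchy–Schwarz it is at least of order `ε₂ ^ 2` if `‖δ‖₁ ≥ ε₂`, and it is at most `T * ε₁` if
`‖δ‖₁ ≤ ε₁`. Points with large deviations break the second bound, but these can be recognized. By
Bernstein's inequality and a union bound (`prob_not_accurate_le`), the empirical frequencies of
`M` samples are `Accurate`, that is, correct at every point up to a quarter of `T * w x + |δ x|`, as
soon as `M * T` and `M * T ^ 2` are both of order at least `N * log N`. So the set of points where
the empirical deviation exceeds `T * w x` can be split off:

* on it the empirical deviations equal the true ones up to a constant factor, and the tester rejects
  if their sum exceeds `ε₂ / 4`;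
* off it `|δ x| = O(T * w x)` holds, and `D` restricted to these points is estimated by the inner
  product `twoBatchStat` of the deviations in two fresh batches of samples.

The estimator is unbiased with variance `O((D + √N * D ^ (3 / 2)) / M + N * (1 + D) / M ^ 2)`, so that
`√N / ε₂ ^ 2` samples separate `D ≥ ε₂ ^ 2 / 8` from `D ≤ ε₂ ^ 2 / 32`
(`expect_prob_twoBatchStat_le`). The remaining requirement `T * ε₁ ≲ ε₂ ^ 2` with the least possible
`T ≈ N * log N / M + √(N * log N / M)` gives the two other terms of the sample bound, at the cost
of a single logarithmic factor.
-/

namespace DistributionTesting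

open Finset

/-! ### Expectations over independent samples -/

/-- The expectation of `f` evaluated at a list of `n` independent samples, each having
probability mass function `p`. It is defined by recursion on `n`, first sample first, to match
the way a decision tree draws its samples. -/
noncomputable def expect {Ω : Type u} [Fintype Ω] (p : Ω → ℝ) : ℕ → (List Ω → ℝ) → ℝ
  | 0, f => f []
  | n + 1, f => ∑ x, p x * expect p n fun l => f (x :: l)

section Expect

variable {Ω : Type u} [Fintype Ω] {p : Ω → ℝ}

theorem expect_mono (hp : ∀ x, 0 ≤ p x) (n : ℕ) {f g : List Ω → ℝ} (h : ∀ l, f l ≤ g l) :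
    expect p n f ≤ expect p n g := by
  induction n generalizing f g with
  | zero => exact h []
  | succ n ih =>
    exact sum_le_sum fun x _ => mul_le_mul_of_nonneg_left (ih fun l => h (x :: l)) (hp x)

theorem expect_add (p : Ω → ℝ) (n : ℕ) (f g : List Ω → ℝ) :
    expect p n (fun l => f l + g l) = expect p n f + expect p n g := by
  induction n generalizing f g with
  | zero => rfl
  | succ n ih => simp only [expect, ih, mul_add, sum_add_distrib]

theorem expect_const_mul (p : Ω → ℝ) (n : ℕ) (c : ℝ) (f : List Ω → ℝ) :
    expect p n (fun l => c * f l) = c * expect p n f := by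
  induction n generalizing f with
  | zero => rfl
  | succ n ih =>
    simp only [expect, ih, mul_sum]
    exact sum_congr rfl fun x _ => by ring

theorem expect_const (hp1 : ∑ x, p x = 1) (n : ℕ) (c : ℝ) :
    expect p n (fun _ => c) = c := by
  induction n with
  | zero => rfl
  | succ n ih => simp only [expect, ih, ← sum_mul, hp1, one_mul]

theorem expect_finset_sum {ι : Type*} (p : Ω → ℝ) (n : ℕ) (s : Finset ι)
    (f : ι → List Ω → ℝ) :
    expect p n (fun l => ∑ i ∈ s, f i l) = ∑ i ∈ s, expect p n (f i) := by
  induction n generalizing f with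
  | zero => rfl
  | succ n ih =>
    simp only [expect, ih, mul_sum]
    exact sum_comm

theorem expect_exp_sum (p g : Ω → ℝ) (n : ℕ) (s : ℝ) :
    expect p n (fun l => Real.exp (s * (l.map g).sum)) =
      (∑ x, p x * Real.exp (s * g x)) ^ n := by
  induction n with
  | zero => simp [expect]
  | succ n ih =>
    simp only [expect, List.map_cons, List.sum_cons, mul_add, Real.exp_add, expect_const_mul, ih,
      pow_succ', sum_mul]
    exact sum_congr rfl fun x _ => by ring

/-- The empirical mean of `g` over a list of `n` samples. The sample size is a separate argument,
to be used with lists of length `n`. -/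
noncomputable def empMean {Ω : Type u} (n : ℕ) (g : Ω → ℝ) (l : List Ω) : ℝ :=
  (l.map g).sum / n

theorem expect_sum (hp1 : ∑ x, p x = 1) (g : Ω → ℝ) (n : ℕ) :
    expect p n (fun l => (l.map g).sum) = n * ∑ x, p x * g x := by
  induction n with
  | zero => simp [expect]
  | succ n ih =>
    simp only [expect, List.map_cons, List.sum_cons, expect_add, expect_const hp1, ih, mul_add,
      sum_add_distrib, ← sum_mul, hp1]
    push_cast
    ring

theorem expect_sum_sq (hp1 : ∑ x, p x = 1) (g : Ω → ℝ) (n : ℕ) :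
    expect p n (fun l => (l.map g).sum ^ 2) =
      n * ∑ x, p x * g x ^ 2 + n * (n - 1) * (∑ x, p x * g x) ^ 2 := by
  induction n with
  | zero => simp [expect]
  | succ n ih =>
    have h : ∀ x, expect p n (fun l => ((x :: l).map g).sum ^ 2) =
        g x ^ 2 + 2 * (n * ∑ x, p x * g x) * g x + (n * ∑ x, p x * g x ^ 2 +
          n * (n - 1) * (∑ x, p x * g x) ^ 2) := by
      intro x
      have : (fun l : List Ω => ((x :: l).map g).sum ^ 2) =
          fun l => (g x ^ 2 + 2 * g x * (l.map g).sum) + (l.map g).sum ^ 2 := by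
        funext l
        simp only [List.map_cons, List.sum_cons]
        ring
      rw [this, expect_add, expect_add, expect_const hp1, expect_const_mul, expect_sum hp1, ih]
      ring
    have h2 : ∑ x, p x * (2 * (n * ∑ x, p x * g x) * g x) =
        2 * (n * ∑ x, p x * g x) * ∑ x, p x * g x := by
      generalize 2 * (n * ∑ x, p x * g x) = a
      rw [mul_sum]
      exact sum_congr rfl fun x _ => by ring
    simp only [expect, h, mul_add (p _), sum_add_distrib, h2, ← sum_mul, hp1]
    push_cast
    ring

theorem expect_empMean (hp1 : ∑ x, p x = 1) (g : Ω → ℝ) {n : ℕ} (hn : 0 < n) :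
    expect p n (empMean n g) = ∑ x, p x * g x := by
  have hn' : (n : ℝ) ≠ 0 := by positivity
  have : empMean n g = fun l => (n : ℝ)⁻¹ * (l.map g).sum := by
    funext l
    rw [empMean, div_eq_inv_mul]
  rw [this, expect_const_mul, expect_sum hp1]
  field_simp

theorem expect_empMean_sq_le (hp1 : ∑ x, p x = 1) (g : Ω → ℝ) {n : ℕ} (hn : 0 < n) :
    expect p n (fun l => empMean n g l ^ 2) ≤
      (∑ x, p x * g x) ^ 2 + (∑ x, p x * g x ^ 2) / n := by
  have hn' : (0 : ℝ) < n := by positivity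
  have : (fun l => empMean n g l ^ 2) = fun l => ((n : ℝ) ^ 2)⁻¹ * (l.map g).sum ^ 2 := by
    funext l
    rw [empMean, div_pow, div_eq_inv_mul]
  rw [this, expect_const_mul, expect_sum_sq hp1]
  have h : ((n : ℝ) ^ 2)⁻¹ * (n * ∑ x, p x * g x ^ 2 + n * (n - 1) * (∑ x, p x * g x) ^ 2) =
      (∑ x, p x * g x) ^ 2 + (∑ x, p x * g x ^ 2) / n - (∑ x, p x * g x) ^ 2 / n := by
    field_simp
    ring
  rw [h]
  have : 0 ≤ (∑ x, p x * g x) ^ 2 / n := by positivity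
  linarith

theorem expect_nonneg (hp : ∀ x, 0 ≤ p x) (n : ℕ) {f : List Ω → ℝ} (h : ∀ l, 0 ≤ f l) :
    0 ≤ expect p n f := by
  induction n generalizing f with
  | zero => exact h []
  | succ n ih => exact sum_nonneg fun x _ => mul_nonneg (hp x) (ih fun l => h (x :: l))

open Classical in
/-- The probability that a list of `n` independent samples satisfies `A`. -/
noncomputable def prob (p : Ω → ℝ) (n : ℕ) (A : List Ω → Prop) : ℝ :=
  expect p n fun l => if A l then 1 else 0

theorem prob_mono (hp : ∀ x, 0 ≤ p x) (n : ℕ) {A B : List Ω → Prop} (h : ∀ l, A l → B l) :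
    prob p n A ≤ prob p n B := by
  refine expect_mono hp n fun l => ?_
  have := h l
  split_ifs <;> simp_all

theorem prob_not (hp1 : ∑ x, p x = 1) (n : ℕ) (A : List Ω → Prop) :
    prob p n (fun l => ¬ A l) = 1 - prob p n A := by
  have h : prob p n (fun l => ¬ A l) + prob p n A = 1 := by
    rw [prob, prob, ← expect_add]
    refine Eq.trans ?_ (expect_const hp1 n 1)
    congr 1
    funext l
    by_cases hA : A l <;> simp [hA]
  linarith

theorem prob_or_le (hp : ∀ x, 0 ≤ p x) (n : ℕ) (A B : List Ω → Prop) :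
    prob p n (fun l => A l ∨ B l) ≤ prob p n A + prob p n B := by
  rw [prob, prob, prob, ← expect_add]
  refine expect_mono hp n fun l => ?_
  by_cases hA : A l <;> by_cases hB : B l <;> simp [hA, hB]

open Classical in
theorem prob_exists_le {ι : Type*} [Fintype ι] (hp : ∀ x, 0 ≤ p x) (n : ℕ)
    (A : ι → List Ω → Prop) :
    prob p n (fun l => ∃ i, A i l) ≤ ∑ i, prob p n (A i) := by
  simp only [prob]
  rw [← expect_finset_sum]
  refine expect_mono hp n fun l => ?_
  have h0 : ∀ i ∈ (univ : Finset ι), (0 : ℝ) ≤ if A i l then 1 else 0 := fun i _ => by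
    split_ifs <;> norm_num
  split_ifs with h
  · obtain ⟨i, hi⟩ := h
    simpa [hi] using single_le_sum h0 (mem_univ i)
  · exact sum_nonneg h0

/-- **Bernstein's inequality** for the upper tail of an empirical mean, with unoptimized
constants. The uncentred second moment of `g` plays the part of the variance. -/
theorem prob_empMean_ge_le (hp : ∀ x, 0 ≤ p x) (hp1 : ∑ x, p x = 1) {g : Ω → ℝ}
    (hg : ∀ x, |g x| ≤ 1) {n : ℕ} (hn : 0 < n) {t v : ℝ} (ht : 0 < t)
    (hv : ∑ x, p x * g x ^ 2 ≤ v) :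
    prob p n (fun l => t ≤ empMean n g l - ∑ x, p x * g x) ≤
      Real.exp (-(n * t ^ 2 / (4 * (v + t)))) := by
  have hn' : (0 : ℝ) < n := by positivity
  have hv0 : 0 ≤ v := (sum_nonneg fun x _ => mul_nonneg (hp x) (sq_nonneg _)).trans hv
  set μ := ∑ x, p x * g x with hμ
  -- This exponent nearly minimizes `v * s ^ 2 - t * s` subject to `s ≤ 1`.
  set s := t / (2 * (v + t)) with hs
  have hs0 : 0 < s := by positivity
  have hs1 : s ≤ 1 := by
    rw [hs, div_le_one (by positivity)]
    linarith
  have hmgf : ∑ x, p x * Real.exp (s * g x) ≤ Real.exp (s * μ + s ^ 2 * v) := by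
    calc ∑ x, p x * Real.exp (s * g x)
        ≤ ∑ x, p x * (1 + s * g x + (s * g x) ^ 2) := by
          refine sum_le_sum fun x _ => mul_le_mul_of_nonneg_left ?_ (hp x)
          have h1 : |s * g x| ≤ 1 := by
            rw [abs_mul, abs_of_pos hs0]
            exact mul_le_one₀ hs1 (abs_nonneg _) (hg x)
          have := (abs_le.1 (Real.abs_exp_sub_one_sub_id_le h1)).2
          linarith
      _ = 1 + s * μ + s ^ 2 * ∑ x, p x * g x ^ 2 := by
          rw [hμ, mul_sum, mul_sum]
          nth_rw 2 [← hp1]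
          rw [← sum_add_distrib, ← sum_add_distrib]
          exact sum_congr rfl fun x _ => by ring
      _ ≤ 1 + s * μ + s ^ 2 * v := by gcongr
      _ ≤ Real.exp (s * μ + s ^ 2 * v) := by
          have := Real.add_one_le_exp (s * μ + s ^ 2 * v)
          linarith
  calc prob p n (fun l => t ≤ empMean n g l - μ)
      ≤ expect p n (fun l => Real.exp (-(s * (n * (μ + t)))) *
          Real.exp (s * (l.map g).sum)) := by
        refine expect_mono hp n fun l => ?_
        rw [← Real.exp_add]
        split_ifs with h
        · have h2 : n * (μ + t) ≤ (l.map g).sum := by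
            have h := le_sub_iff_add_le.1 h
            rw [empMean, le_div_iff₀ hn'] at h
            linarith
          rw [Real.one_le_exp_iff]
          have := mul_le_mul_of_nonneg_left h2 hs0.le
          linarith
        · positivity
    _ = Real.exp (-(s * (n * (μ + t)))) * (∑ x, p x * Real.exp (s * g x)) ^ n := by
        rw [expect_const_mul, expect_exp_sum]
    _ ≤ Real.exp (-(s * (n * (μ + t)))) * Real.exp (s * μ + s ^ 2 * v) ^ n := by
        have : 0 ≤ ∑ x, p x * Real.exp (s * g x) :=
          sum_nonneg fun x _ => mul_nonneg (hp x) (Real.exp_pos _).le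
        gcongr
    _ = Real.exp (n * (s * (s * v - t))) := by
        rw [← Real.exp_nat_mul, ← Real.exp_add]
        congr 1
        ring
    _ ≤ Real.exp (-(n * t ^ 2 / (4 * (v + t)))) := by
        rw [Real.exp_le_exp]
        have h1 : s * v ≤ t / 2 := by
          rw [hs, div_mul_eq_mul_div, div_le_div_iff₀ (by positivity) (by positivity)]
          nlinarith
        have h2 : n * t ^ 2 / (4 * (v + t)) = n * (s * (t / 2)) := by
          rw [hs]
          field_simp
          ring
        rw [h2, ← mul_neg, ← mul_neg]
        gcongr
        linarith

end Expect

/-! ### Empirical frequencies -/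

section Frequencies

variable {Ω : Type u} [Fintype Ω] {p q : Ω → ℝ}

open Classical in
/-- The empirical frequency of the point `x` in a list of `n` samples. -/
noncomputable def freq (n : ℕ) (l : List Ω) (x : Ω) : ℝ :=
  empMean n (fun y => if y = x then 1 else 0) l

theorem sum_freq_mul (n : ℕ) (l : List Ω) (g : Ω → ℝ) :
    ∑ x, freq n l x * g x = empMean n g l := by
  classical
  simp only [freq, empMean, div_mul_eq_mul_div, ← sum_div]
  congr 1
  induction l with
  | nil => simp
  | cons y l ih =>
    simp only [List.map_cons, List.sum_cons, add_mul, sum_add_distrib, ih]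
    simp

theorem prob_lt_abs_freq_sub_le (hp : ∀ x, 0 ≤ p x) (hp1 : ∑ x, p x = 1) {n : ℕ} (hn : 0 < n)
    (x : Ω) {t : ℝ} (ht : 0 < t) :
    prob p n (fun l => t < |freq n l x - p x|) ≤
      2 * Real.exp (-(n * t ^ 2 / (4 * (p x + t)))) := by
  classical
  set g : Ω → ℝ := fun y => if y = x then 1 else 0 with hg
  have hμ : ∑ y, p y * g y = p x := by simp [hg]
  have hv : ∑ y, p y * g y ^ 2 ≤ p x := by simp [hg]
  have hμ' : ∑ y, p y * (-g) y = -p x := by simp [hg]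
  have hv' : ∑ y, p y * (-g) y ^ 2 ≤ p x := by simpa using hv
  have hg1 : ∀ y, |g y| ≤ 1 := fun y => by
    simp only [hg]
    split_ifs <;> simp
  have hg1' : ∀ y, |(-g) y| ≤ 1 := fun y => by simpa using hg1 y
  have hneg : ∀ l, empMean n (-g) l = -freq n l x := by
    intro l
    rw [← sum_freq_mul, freq, ← sum_freq_mul, ← sum_neg_distrib]
    simp only [Pi.neg_apply, mul_neg]
    rfl
  have h1 := prob_empMean_ge_le hp hp1 hg1 hn ht hv
  have h2 := prob_empMean_ge_le hp hp1 hg1' hn ht hv'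
  refine ((prob_mono hp n fun l hl => ?_).trans (prob_or_le hp n _ _)).trans
    ((add_le_add h1 h2).trans_eq (two_mul _).symm)
  rw [hμ, hμ', hneg]
  rcases lt_abs.1 hl with h | h
  · exact Or.inl h.le
  · refine Or.inr ?_
    linarith

/-- The weight `q x + 1 / |Ω|` by which deviations from the reference distribution `q` are
measured. It dominates `q`, is at least `1 / |Ω|` everywhere, and has total mass `2`. -/
noncomputable def refWeight (q : Ω → ℝ) (x : Ω) : ℝ :=
  q x + 1 / Fintype.card Ω

theorem le_refWeight (q : Ω → ℝ) (x : Ω) : q x ≤ refWeight q x :=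
  le_add_of_nonneg_right (by positivity)

theorem inv_card_le_refWeight (hq : ∀ x, 0 ≤ q x) (x : Ω) :
    1 / (Fintype.card Ω : ℝ) ≤ refWeight q x :=
  le_add_of_nonneg_left (hq x)

theorem refWeight_pos (hq : ∀ x, 0 ≤ q x) (x : Ω) : 0 < refWeight q x := by
  have : 0 < Fintype.card Ω := Fintype.card_pos_iff.2 ⟨x⟩
  exact lt_of_lt_of_le (by positivity) (inv_card_le_refWeight hq x)

theorem one_le_card_mul_refWeight (hq : ∀ x, 0 ≤ q x) (x : Ω) :
    1 ≤ Fintype.card Ω * refWeight q x := by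
  have : (0 : ℝ) < Fintype.card Ω := by
    exact_mod_cast Fintype.card_pos_iff.2 ⟨x⟩
  have h := inv_card_le_refWeight hq x
  rwa [div_le_iff₀' this] at h

theorem sum_refWeight [Nonempty Ω] (hq1 : ∑ x, q x = 1) : ∑ x, refWeight q x = 2 := by
  simp only [refWeight, sum_add_distrib, hq1, sum_const, card_univ, nsmul_eq_mul]
  rw [mul_one_div_cancel (by simp)]
  norm_num

/-- The empirical frequencies of a sample from `p` are accurate at relative resolution `T`:
the error at each point is at most a quarter of `T` times the weight, or of the deviation of `p`
from the reference `q`, up to adding the two. -/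
def Accurate (p q : Ω → ℝ) (n : ℕ) (T : ℝ) (l : List Ω) : Prop :=
  ∀ x, |freq n l x - p x| ≤ (T * refWeight q x + |p x - q x|) / 4

theorem prob_not_accurate_le (hp : ∀ x, 0 ≤ p x) (hp1 : ∑ x, p x = 1)
    (hq : ∀ x, 0 ≤ q x) {n : ℕ} (hn : 0 < n) {L T : ℝ} (hT : 0 < T)
    (hT1 : 160 * L * Fintype.card Ω ≤ n * T) (hT2 : 128 * L * Fintype.card Ω ≤ n * T ^ 2) :
    prob p n (fun l => ¬ Accurate p q n T l) ≤ 2 * Fintype.card Ω * Real.exp (-L) := by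
  have hn' : (0 : ℝ) < n := by positivity
  have key : ∀ x, prob p n (fun l =>
      (T * refWeight q x + |p x - q x|) / 4 < |freq n l x - p x|) ≤ 2 * Real.exp (-L) := by
    intro x
    set w := refWeight q x with hw
    set N := (Fintype.card Ω : ℝ) with hN
    have hw0 : 0 < w := refWeight_pos hq x
    have hNw : 1 ≤ N * w := one_le_card_mul_refWeight hq x
    set t := (T * w + |p x - q x|) / 4 with ht
    have htw : T * w / 4 ≤ t := by
      have := abs_nonneg (p x - q x)
      rw [ht]
      linarith
    have ht0 : 0 < t := lt_of_lt_of_le (by positivity) htw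
    have hpt : p x ≤ w + 4 * t := by
      have h1 := le_abs_self (p x - q x)
      have h2 : q x ≤ w := le_refWeight q x
      have h3 : 0 < T * w := by positivity
      rw [ht]
      linarith
    refine (prob_lt_abs_freq_sub_le hp hp1 hn x ht0).trans ?_
    have hpx := hp x
    rcases le_or_gt L 0 with hL | hL
    · have h1 : Real.exp (-(n * t ^ 2 / (4 * (p x + t)))) ≤ 1 := by
        rw [Real.exp_le_one_iff, neg_nonpos]
        positivity
      have h2 : 1 ≤ Real.exp (-L) := Real.one_le_exp (by linarith)
      linarith
    gcongr
    rw [le_div_iff₀ (by positivity)]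
    -- The resolution is chosen so that each half of `n * t ^ 2` pays for one part of `w + 5 * t`.
    have h1 : 20 * L * t ≤ n * t ^ 2 / 2 := by
      have : 160 * L ≤ n * T * w := by
        calc 160 * L ≤ 160 * L * (N * w) := le_mul_of_one_le_right (by positivity) hNw
          _ = (160 * L * N) * w := by ring
          _ ≤ n * T * w := by gcongr
      have h40 : 40 * L ≤ n * t := by
        have := mul_le_mul_of_nonneg_left htw hn'.le
        linarith
      nlinarith
    have h2 : 4 * L * w ≤ n * t ^ 2 / 2 := by
      calc 4 * L * w ≤ 4 * L * w * (N * w) := le_mul_of_one_le_right (by positivity) hNw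
        _ = (128 * L * N) * w ^ 2 / 32 := by ring
        _ ≤ n * T ^ 2 * w ^ 2 / 32 := by gcongr
        _ = n * (T * w / 4) ^ 2 / 2 := by ring
        _ ≤ n * t ^ 2 / 2 := by gcongr
    nlinarith
  calc prob p n (fun l => ¬ Accurate p q n T l)
      ≤ prob p n (fun l => ∃ x, (T * refWeight q x + |p x - q x|) / 4 < |freq n l x - p x|) := by
        refine prob_mono hp n fun l hl => ?_
        simpa only [Accurate, not_forall, not_le] using hl
    _ ≤ ∑ x, prob p n (fun l =>
          (T * refWeight q x + |p x - q x|) / 4 < |freq n l x - p x|) := prob_exists_le hp n _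
    _ ≤ ∑ _x : Ω, 2 * Real.exp (-L) := sum_le_sum fun x _ => key x
    _ = 2 * Fintype.card Ω * Real.exp (-L) := by
        rw [sum_const, card_univ, nsmul_eq_mul]
        ring

/-! ### The points with a large empirical deviation -/

open Classical in
/-- The points at which the empirical frequency deviates from the reference `q` by more than `T`
times the weight. -/
noncomputable def largeDev (q : Ω → ℝ) (n : ℕ) (T : ℝ) (l : List Ω) : Finset Ω :=
  univ.filter fun x => T * refWeight q x < |freq n l x - q x|

open Classical in
/-- The points at which the empirical frequency deviates from the reference `q` by at most `T`
times the weight. -/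
noncomputable def smallDev (q : Ω → ℝ) (n : ℕ) (T : ℝ) (l : List Ω) : Finset Ω :=
  univ.filter fun x => ¬ T * refWeight q x < |freq n l x - q x|

/-- The `χ²`-type distance between `p` and `q`, with respect to the weight `refWeight q`, carried
by the points of `F`. -/
noncomputable def chiSq (p q : Ω → ℝ) (F : Finset Ω) : ℝ :=
  ∑ x ∈ F, (p x - q x) ^ 2 / refWeight q x

theorem chiSq_nonneg (hq : ∀ x, 0 ≤ q x) (F : Finset Ω) : 0 ≤ chiSq p q F :=
  sum_nonneg fun x _ => div_nonneg (sq_nonneg _) (refWeight_pos hq x).le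

theorem sum_largeDev_add_sum_smallDev (q : Ω → ℝ) (n : ℕ) (T : ℝ) (l : List Ω) (f : Ω → ℝ) :
    ∑ x ∈ largeDev q n T l, f x + ∑ x ∈ smallDev q n T l, f x = ∑ x, f x := by
  classical
  exact sum_filter_add_sum_filter_not _ _ _

theorem Accurate.sum_abs_freq_sub_le {n : ℕ} {T : ℝ} {l : List Ω} (h : Accurate p q n T l) :
    ∑ x ∈ largeDev q n T l, |freq n l x - q x| ≤ 5 / 3 * ∑ x, |p x - q x| := by
  rw [mul_sum]
  refine (sum_le_sum fun x hx => ?_).trans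
    (sum_le_sum_of_subset_of_nonneg (subset_univ _) fun x _ _ => by positivity)
  have hx := (mem_filter.1 hx).2
  have h1 := h x
  have h2 := abs_sub_le (freq n l x) (p x) (q x)
  linarith

theorem Accurate.sum_abs_sub_le {n : ℕ} {T : ℝ} {l : List Ω} (h : Accurate p q n T l) :
    ∑ x ∈ largeDev q n T l, |p x - q x| ≤
      5 / 3 * ∑ x ∈ largeDev q n T l, |freq n l x - q x| := by
  rw [mul_sum]
  refine sum_le_sum fun x hx => ?_
  have hx := (mem_filter.1 hx).2
  have h1 := h x
  have h2 := abs_sub_le (p x) (freq n l x) (q x)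
  rw [abs_sub_comm (p x) (freq n l x)] at h2
  linarith

/-- Away from the large empirical deviations every true deviation is `O(T)` times the weight, so
the `χ²`-type distance is at most linear in the `ℓ₁` distance. -/
theorem Accurate.chiSq_le (hq : ∀ x, 0 ≤ q x) {n : ℕ} {T : ℝ} (hT : 0 ≤ T) {l : List Ω}
    (h : Accurate p q n T l) :
    chiSq p q (smallDev q n T l) ≤ 5 / 3 * T * ∑ x, |p x - q x| := by
  rw [chiSq, mul_sum]
  refine (sum_le_sum fun x hx => ?_).trans
    (sum_le_sum_of_subset_of_nonneg (subset_univ _) fun x _ _ => by positivity)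
  have hx := not_lt.1 (mem_filter.1 hx).2
  have h1 := h x
  have h2 := abs_sub_le (p x) (freq n l x) (q x)
  rw [abs_sub_comm (p x) (freq n l x)] at h2
  have h3 : |p x - q x| ≤ 5 / 3 * T * refWeight q x := by linarith
  rw [div_le_iff₀ (refWeight_pos hq x), ← sq_abs, sq]
  nlinarith [abs_nonneg (p x - q x)]

/-- By Cauchy–Schwarz, as the weight has total mass `2`. -/
theorem sq_sum_abs_sub_le_chiSq [Nonempty Ω] (hq : ∀ x, 0 ≤ q x) (hq1 : ∑ x, q x = 1)
    (F : Finset Ω) :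
    (∑ x ∈ F, |p x - q x|) ^ 2 ≤ 2 * chiSq p q F := by
  have h := sum_sq_le_sum_mul_sum_of_sq_le_mul F (r := fun x => |p x - q x|)
    (f := fun x => (p x - q x) ^ 2 / refWeight q x) (g := refWeight q)
    (fun x _ => div_nonneg (sq_nonneg _) (refWeight_pos hq x).le)
    (fun x _ => (refWeight_pos hq x).le)
    (fun x _ => by rw [sq_abs, div_mul_cancel₀ _ (refWeight_pos hq x).ne'])
  have h2 : ∑ x ∈ F, refWeight q x ≤ 2 := by
    rw [← sum_refWeight hq1]
    exact sum_le_sum_of_subset_of_nonneg (subset_univ _) fun x _ _ => (refWeight_pos hq x).le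
  calc _ ≤ _ := h
    _ ≤ chiSq p q F * 2 := mul_le_mul_of_nonneg_left h2 (chiSq_nonneg hq F)
    _ = _ := mul_comm _ _

/-! ### The two-batch estimator of the `χ²`-type distance -/

/-- The estimator of `chiSq p q F` from two independent batches of `n` samples of `p` each. Its
bilinearity in the two batches makes it unbiased. -/
noncomputable def twoBatchStat (q : Ω → ℝ) (F : Finset Ω) (n : ℕ) (a b : List Ω) : ℝ :=
  ∑ x ∈ F, (freq n b x - q x) * (freq n a x - q x) / refWeight q x

theorem expect_sq_empMean_sub_le (hp1 : ∑ x, p x = 1) (g : Ω → ℝ) {n : ℕ} (hn : 0 < n) (c : ℝ) :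
    expect p n (fun l => (empMean n g l - c) ^ 2) ≤
      (∑ x, p x * g x - c) ^ 2 + (∑ x, p x * g x ^ 2) / n := by
  have h : (fun l => (empMean n g l - c) ^ 2) =
      fun l => (empMean n g l ^ 2 + (-2 * c) * empMean n g l) + c ^ 2 := by
    funext l
    ring
  rw [h, expect_add, expect_add, expect_const hp1, expect_const_mul, expect_empMean hp1 g hn]
  linarith [expect_empMean_sq_le hp1 g hn]

theorem expect_sq_freq_sub_le (hp1 : ∑ x, p x = 1) {n : ℕ} (hn : 0 < n) (x : Ω) (c : ℝ) :
    expect p n (fun l => (freq n l x - c) ^ 2) ≤ (p x - c) ^ 2 + p x / n := by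
  classical
  refine (expect_sq_empMean_sub_le hp1 _ hn c).trans_eq ?_
  simp

theorem expect_sq_sum_freq_sub_le (hp1 : ∑ x, p x = 1) (q : Ω → ℝ) (F : Finset Ω) (g : Ω → ℝ)
    {n : ℕ} (hn : 0 < n) (c : ℝ) :
    expect p n (fun l => (∑ x ∈ F, (freq n l x - q x) * g x - c) ^ 2) ≤
      (∑ x ∈ F, (p x - q x) * g x - c) ^ 2 + (∑ x ∈ F, p x * g x ^ 2) / n := by
  classical
  set β : Ω → ℝ := fun x => if x ∈ F then g x else 0 with hβ
  have hF : ∀ f : Ω → ℝ, ∑ x ∈ F, f x * g x = ∑ x, f x * β x := fun f => by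
    simp [hβ, mul_ite, sum_ite_mem]
  have hF2 : ∑ x ∈ F, p x * g x ^ 2 = ∑ x, p x * β x ^ 2 := by
    simp [hβ, ite_pow, mul_ite, sum_ite_mem]
  have h := expect_sq_empMean_sub_le hp1 β hn (∑ x, q x * β x + c)
  simp only [hF, hF2, sub_mul, sum_sub_distrib, sum_freq_mul, sub_sub]
  exact h

theorem expect_sq_twoBatchStat_sub_le (hp : ∀ x, 0 ≤ p x) (hp1 : ∑ x, p x = 1) (q : Ω → ℝ)
    (F : Finset Ω) {n : ℕ} (hn : 0 < n) :
    expect p n (fun a => expect p n fun b =>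
        (twoBatchStat q F n a b - chiSq p q F) ^ 2) ≤
      2 * (∑ x ∈ F, p x * ((p x - q x) / refWeight q x) ^ 2) / n +
        (∑ x ∈ F, (p x / refWeight q x) ^ 2) / n ^ 2 := by
  have hn' : (0 : ℝ) < n := by positivity
  set w := refWeight q with hw
  have h1 : ∀ a, expect p n (fun b => (twoBatchStat q F n a b - chiSq p q F) ^ 2) ≤
      (∑ x ∈ F, (freq n a x - q x) * ((p x - q x) / w x) - chiSq p q F) ^ 2 +
        ∑ x ∈ F, p x / w x ^ 2 / n * (freq n a x - q x) ^ 2 := by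
    intro a
    have h := expect_sq_sum_freq_sub_le hp1 q F (fun x => (freq n a x - q x) / w x) hn (chiSq p q F)
    simp only [← mul_div_assoc] at h
    refine h.trans_eq ?_
    congr 1
    · congr 2
      exact sum_congr rfl fun x _ => by ring
    · rw [sum_div]
      exact sum_congr rfl fun x _ => by ring
  have h2 := expect_sq_sum_freq_sub_le hp1 q F (fun x => (p x - q x) / w x) hn (chiSq p q F)
  have h3 : ∑ x ∈ F, (p x - q x) * ((p x - q x) / w x) = chiSq p q F :=
    sum_congr rfl fun x _ => by ring
  rw [h3, sub_self, zero_pow two_ne_zero, zero_add] at h2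
  calc _ ≤ _ := expect_mono hp n h1
    _ = expect p n (fun a =>
          (∑ x ∈ F, (freq n a x - q x) * ((p x - q x) / w x) - chiSq p q F) ^ 2) +
        ∑ x ∈ F, p x / w x ^ 2 / n * expect p n (fun a => (freq n a x - q x) ^ 2) := by
      rw [expect_add, expect_finset_sum]
      simp only [expect_const_mul]
    _ ≤ (∑ x ∈ F, p x * ((p x - q x) / w x) ^ 2) / n +
        ∑ x ∈ F, p x / w x ^ 2 / n * ((p x - q x) ^ 2 + p x / n) := by
      refine add_le_add h2 (sum_le_sum fun x _ => mul_le_mul_of_nonneg_left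
        (expect_sq_freq_sub_le hp1 hn x (q x)) ?_)
      have := hp x
      positivity
    _ = _ := by
      have h4 : ∀ x, p x / w x ^ 2 / n * ((p x - q x) ^ 2 + p x / n) =
          p x * ((p x - q x) / w x) ^ 2 / n + (p x / w x) ^ 2 / n ^ 2 := fun x => by ring
      simp only [h4, sum_add_distrib, ← sum_div]
      ring

theorem sum_mul_sq_div_refWeight_le (hq : ∀ x, 0 ≤ q x) (F : Finset Ω) :
    ∑ x ∈ F, p x * ((p x - q x) / refWeight q x) ^ 2 ≤
      (1 + √(Fintype.card Ω) * √(chiSq p q F)) * chiSq p q F := by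
  have hsum : (1 + √(Fintype.card Ω) * √(chiSq p q F)) * chiSq p q F = ∑ x ∈ F,
      (1 + √(Fintype.card Ω) * √(chiSq p q F)) * ((p x - q x) ^ 2 / refWeight q x) :=
    mul_sum _ _ _
  rw [hsum]
  refine sum_le_sum fun x hx => ?_
  have hw := refWeight_pos hq x
  have hNw := one_le_card_mul_refWeight hq x
  set N := (Fintype.card Ω : ℝ) with hN
  set w := refWeight q x with hwdef
  have hterm : (p x - q x) ^ 2 / w ≤ chiSq p q F :=
    single_le_sum (f := fun x => (p x - q x) ^ 2 / refWeight q x)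
      (fun y _ => div_nonneg (sq_nonneg _) (refWeight_pos hq y).le) hx
  have hdev : |p x - q x| / w ≤ √N * √(chiSq p q F) := by
    rw [← Real.sqrt_mul (by positivity)]
    refine Real.le_sqrt_of_sq_le ?_
    calc (|p x - q x| / w) ^ 2 = (p x - q x) ^ 2 / w ^ 2 := by rw [div_pow, sq_abs]
      _ ≤ (p x - q x) ^ 2 / w ^ 2 * (N * w) := le_mul_of_one_le_right (by positivity) hNw
      _ = N * ((p x - q x) ^ 2 / w) := by field_simp
      _ ≤ N * chiSq p q F := by gcongr
  have hratio : p x / w ≤ 1 + √N * √(chiSq p q F) := by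
    have h1 : p x ≤ w + |p x - q x| := by
      have := le_abs_self (p x - q x)
      have := le_refWeight q x
      linarith
    calc p x / w ≤ (w + |p x - q x|) / w := by gcongr
      _ = 1 + |p x - q x| / w := by rw [add_div, div_self hw.ne']
      _ ≤ _ := by gcongr
  calc p x * ((p x - q x) / w) ^ 2 = p x / w * ((p x - q x) ^ 2 / w) := by ring
    _ ≤ _ := by gcongr

theorem sum_sq_div_refWeight_le (hq : ∀ x, 0 ≤ q x) (hq1 : ∑ x, q x = 1) (F : Finset Ω) :
    ∑ x ∈ F, (p x / refWeight q x) ^ 2 ≤ 2 * Fintype.card Ω * (1 + chiSq p q F) := by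
  set N := (Fintype.card Ω : ℝ) with hN
  calc ∑ x ∈ F, (p x / refWeight q x) ^ 2
      ≤ ∑ x ∈ F, (2 * N * q x + 2 * N * ((p x - q x) ^ 2 / refWeight q x)) := by
        refine sum_le_sum fun x _ => ?_
        have hw := refWeight_pos hq x
        have hNw := one_le_card_mul_refWeight hq x
        have hqw := le_refWeight q x
        have hqx := hq x
        set w := refWeight q x with hwdef
        rw [div_pow, div_le_iff₀ (by positivity)]
        have h1 : q x ^ 2 ≤ N * q x * w ^ 2 := by
          calc q x ^ 2 = q x * q x := sq _
            _ ≤ q x * w := by gcongr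
            _ ≤ q x * w * (N * w) := le_mul_of_one_le_right (by positivity) hNw
            _ = _ := by ring
        have h2 : (p x - q x) ^ 2 ≤ N * ((p x - q x) ^ 2 / w) * w ^ 2 := by
          calc (p x - q x) ^ 2 ≤ (p x - q x) ^ 2 * (N * w) :=
              le_mul_of_one_le_right (by positivity) hNw
            _ = _ := by field_simp
        nlinarith [sq_nonneg (p x - 2 * q x)]
    _ = 2 * N * (∑ x ∈ F, q x + chiSq p q F) := by
        rw [sum_add_distrib, ← mul_sum, ← mul_sum, chiSq]
        ring
    _ ≤ 2 * N * (1 + chiSq p q F) := by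
        rw [← hq1]
        gcongr
        · exact fun x _ _ => hq x
        · exact subset_univ _

/-- With `O(√|Ω| / τ)` samples the estimator is accurate up to half the larger of `τ` and its
mean, with probability `9 / 10`, by Chebyshev's inequality. -/
theorem expect_prob_twoBatchStat_le [Nonempty Ω] (hp : ∀ x, 0 ≤ p x) (hp1 : ∑ x, p x = 1)
    (hq : ∀ x, 0 ≤ q x) (hq1 : ∑ x, q x = 1) (F : Finset Ω) {n : ℕ} {τ : ℝ} (hτ : 0 < τ)
    (hτ1 : τ ≤ 1) (hn : 625 * √(Fintype.card Ω) ≤ τ * n) :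
    expect p n (fun a => prob p n fun b =>
        max (chiSq p q F) τ / 2 ≤ |twoBatchStat q F n a b - chiSq p q F|) ≤ 1 / 10 := by
  have hV := sum_mul_sq_div_refWeight_le (p := p) hq F
  have hQ := sum_sq_div_refWeight_le (p := p) hq hq1 F
  have hD0 := chiSq_nonneg (p := p) hq F
  set D := chiSq p q F with hD
  set V := ∑ x ∈ F, p x * ((p x - q x) / refWeight q x) ^ 2
  set Q := ∑ x ∈ F, (p x / refWeight q x) ^ 2
  set Δ := max D τ with hΔ
  have hDΔ : D ≤ Δ := le_max_left _ _
  have hτΔ : τ ≤ Δ := le_max_right _ _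
  have hΔ0 : 0 < Δ := hτ.trans_le hτΔ
  have hs2 : √(Fintype.card Ω : ℝ) ^ 2 = Fintype.card Ω := Real.sq_sqrt (by positivity)
  rw [← hs2] at hQ
  have hs : 1 ≤ √(Fintype.card Ω : ℝ) := by
    rw [Real.one_le_sqrt]
    exact_mod_cast Fintype.card_pos
  set s := √(Fintype.card Ω : ℝ)
  have hn0 : 0 < n := by
    rcases Nat.eq_zero_or_pos n with rfl | h
    · norm_num at hn
      linarith
    · exact h
  have hn' : (0 : ℝ) < n := by positivity
  have hinv : 1 / (n : ℝ) ≤ τ / (625 * s) := by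
    rw [div_le_div_iff₀ hn' (by positivity)]
    linarith
  have hτD : τ * √D ≤ Δ := by
    refine abs_le_of_sq_le_sq' ?_ hΔ0.le |>.2
    rw [mul_pow, Real.sq_sqrt hD0]
    calc τ ^ 2 * D = τ * (τ * D) := by ring
      _ ≤ 1 * (Δ * Δ) := by gcongr
      _ = Δ ^ 2 := by ring
  have hVn : V / n ≤ 2 * Δ ^ 2 / 625 := by
    calc V / n ≤ (1 + s * √D) * D * (1 / n) := by
          rw [div_eq_mul_one_div]
          gcongr
      _ ≤ (s + s * √D) * D * (τ / (625 * s)) := by gcongr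
      _ = (τ * D + τ * √D * D) / 625 := by field_simp
      _ ≤ (Δ * Δ + Δ * Δ) / 625 := by gcongr
      _ = _ := by ring
  have hQn : Q / n ^ 2 ≤ 4 * Δ ^ 2 / 625 ^ 2 := by
    calc Q / n ^ 2 ≤ 2 * s ^ 2 * (1 + D) * (1 / n) ^ 2 := by
          rw [div_eq_mul_one_div, one_div_pow]
          gcongr
      _ ≤ 2 * s ^ 2 * (1 + D) * (τ / (625 * s)) ^ 2 := by gcongr
      _ = 2 * (τ ^ 2 + τ * τ * D) / 625 ^ 2 := by
          field_simp
      _ ≤ 2 * (Δ ^ 2 + 1 * Δ * Δ) / 625 ^ 2 := by gcongr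
      _ = _ := by ring
  have hvar := expect_sq_twoBatchStat_sub_le hp hp1 q F hn0
  calc _ ≤ expect p n (fun a => 4 / Δ ^ 2 * expect p n fun b =>
          (twoBatchStat q F n a b - D) ^ 2) := by
        refine expect_mono hp n fun a => ?_
        rw [← expect_const_mul]
        refine expect_mono hp n fun b => ?_
        split_ifs with h
        · have h2 : (Δ / 2) ^ 2 ≤ (twoBatchStat q F n a b - D) ^ 2 := by
            rw [← sq_abs (twoBatchStat q F n a b - D)]
            gcongr
          rw [div_mul_eq_mul_div, le_div_iff₀ (by positivity)]
          linarith
        · positivity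
    _ ≤ 4 / Δ ^ 2 * (2 * V / n + Q / n ^ 2) := by
        rw [expect_const_mul]
        gcongr
    _ ≤ 4 / Δ ^ 2 * (2 * (2 * Δ ^ 2 / 625) + 4 * Δ ^ 2 / 625 ^ 2) := by
        rw [mul_div_assoc]
        gcongr
    _ ≤ 1 / 10 := by
        field_simp
        norm_num

end Frequencies

/-! ### The tester -/

section IdentityTester

variable {Ω : Type u}

/-- Draw `n` samples from the unknown distribution and continue with the list of them. -/
def Tester.draw : ℕ → (List Ω → Tester Ω) → Tester Ω
  | 0, k => k []
  | n + 1, k => .sampUnknown fun x => Tester.draw n fun l => k (x :: l)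

open Classical in
/-- Evaluate the reference distribution at the points of a list and continue with the function
that `q` becomes when its values there are replaced by the answers. -/
noncomputable def Tester.evalList : List Ω → (Ω → ℝ) → ((Ω → ℝ) → Tester Ω) → Tester Ω
  | [], q, k => k q
  | x :: l, q, k => .evalRef x fun r => Tester.evalList l (Function.update q x r) k

theorem Tester.sampleCount_draw_le (n : ℕ) {k : List Ω → Tester Ω} {m : ℕ∞}
    (h : ∀ l, (k l).sampleCount ≤ m) : (Tester.draw n k).sampleCount ≤ n + m := by
  induction n generalizing k with
  | zero => simpa [Tester.draw] using h []
  | succ n ih =>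
    rw [Tester.draw, Tester.sampleCount, Nat.cast_succ, add_comm (n : ℕ∞) 1, add_assoc]
    gcongr
    exact iSup_le fun x => ih fun l => h (x :: l)

theorem Tester.sampleCount_evalList_le (l : List Ω) {q : Ω → ℝ} {k : (Ω → ℝ) → Tester Ω} {m : ℕ∞}
    (h : ∀ q, (k q).sampleCount ≤ m) : (Tester.evalList l q k).sampleCount ≤ m := by
  induction l generalizing q with
  | nil => exact h q
  | cons x l ih =>
    rw [Tester.evalList, Tester.sampleCount]
    exact iSup_le fun r => ih

theorem Tester.run_draw [Fintype Ω] (P Pref : PMF Ω) (n : ℕ) (k : List Ω → Tester Ω) (b : Bool) :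
    ((Tester.draw n k).run P Pref b).toReal =
      expect (fun x => (P x).toReal) n fun l => ((k l).run P Pref b).toReal := by
  induction n generalizing k with
  | zero => rfl
  | succ n ih =>
    rw [Tester.draw, Tester.run, PMF.bind_apply, tsum_fintype, ENNReal.toReal_sum
      fun x _ => ENNReal.mul_ne_top (PMF.apply_ne_top _ _) (PMF.apply_ne_top _ _)]
    simp only [ENNReal.toReal_mul, ih]
    rfl

theorem Tester.run_evalList (P Pref : PMF Ω) (l : List Ω) (q : Ω → ℝ)
    (k : (Ω → ℝ) → Tester Ω) (h : ∀ x, x ∉ l → q x = (Pref x).toReal) :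
    (Tester.evalList l q k).run P Pref = (k fun x => (Pref x).toReal).run P Pref := by
  classical
  induction l generalizing q with
  | nil =>
    rw [Tester.evalList, funext fun x => h x (by simp)]
  | cons x l ih =>
    rw [Tester.evalList, Tester.run]
    refine ih _ fun y hy => ?_
    by_cases hyx : y = x
    · subst hyx
      simp
    · rw [Function.update_of_ne hyx]
      exact h y (by simp [hyx, hy])

variable [Fintype Ω]

/-- The acceptance condition of the tester: the deviations that the samples `l` show to be large
have a small sum, and at the remaining points the `χ²`-type distance estimated from the samples
`a` and `b` is small. -/
def Accepts (q : Ω → ℝ) (n : ℕ) (T ε : ℝ) (l a b : List Ω) : Prop :=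
  ∑ x ∈ largeDev q n T l, |freq n l x - q x| ≤ ε / 4 ∧
    twoBatchStat q (smallDev q n T l) n a b ≤ ε ^ 2 / 16

open Classical in
/-- The tester that reads the whole reference distribution, draws three batches of `n` samples
from the unknown one, and answers according to `Accepts`. -/
noncomputable def identityTester (Ω : Type u) [Fintype Ω] (n : ℕ) (T ε : ℝ) : Tester Ω :=
  Tester.evalList univ.toList 0 fun q => Tester.draw n fun l => Tester.draw n fun a =>
    Tester.draw n fun b => .answer (decide (Accepts q n T ε l a b))

theorem sampleCount_identityTester_le (n : ℕ) (T ε : ℝ) :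
    (identityTester Ω n T ε).sampleCount ≤ ((3 * n : ℕ) : ℕ∞) := by
  have h : ((3 * n : ℕ) : ℕ∞) = n + (n + (n + 0)) := by
    push_cast
    ring
  rw [h]
  refine Tester.sampleCount_evalList_le _ fun q => ?_
  refine Tester.sampleCount_draw_le n fun l => ?_
  refine Tester.sampleCount_draw_le n fun a => ?_
  refine Tester.sampleCount_draw_le n fun b => ?_
  simp [Tester.sampleCount]

theorem run_identityTester_true (P Pref : PMF Ω) (n : ℕ) (T ε : ℝ) :
    ((identityTester Ω n T ε).run P Pref true).toReal =
      expect (fun x => (P x).toReal) n fun l => expect (fun x => (P x).toReal) n fun a =>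
        prob (fun x => (P x).toReal) n fun b =>
          Accepts (fun x => (Pref x).toReal) n T ε l a b := by
  rw [identityTester, Tester.run_evalList _ _ _ _ _ fun x hx => absurd (by simp) hx]
  simp only [Tester.run_draw, Tester.run, PMF.pure_apply, prob]
  refine congrArg _ (funext fun l => congrArg _ (funext fun a => congrArg _ (funext fun b => ?_)))
  by_cases h : Accepts (fun x => (Pref x).toReal) n T ε l a b <;> simp [h]

theorem run_identityTester_false (P Pref : PMF Ω) (n : ℕ) (T ε : ℝ) :
    ((identityTester Ω n T ε).run P Pref false).toReal =
      expect (fun x => (P x).toReal) n fun l => expect (fun x => (P x).toReal) n fun a =>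
        prob (fun x => (P x).toReal) n fun b =>
          ¬ Accepts (fun x => (Pref x).toReal) n T ε l a b := by
  rw [identityTester, Tester.run_evalList _ _ _ _ _ fun x hx => absurd (by simp) hx]
  simp only [Tester.run_draw, Tester.run, PMF.pure_apply, prob]
  refine congrArg _ (funext fun l => congrArg _ (funext fun a => congrArg _ (funext fun b => ?_)))
  by_cases h : Accepts (fun x => (Pref x).toReal) n T ε l a b <;> simp [h]

/-! ### Correctness -/

variable {p q : Ω → ℝ}

/-- An event over three batches of samples has probability at least `4 / 5` if it follows, for
accurate first batches, from the estimator being accurate on the two others. -/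
theorem four_fifths_le_expect [Nonempty Ω] (hp : ∀ x, 0 ≤ p x) (hp1 : ∑ x, p x = 1)
    (hq : ∀ x, 0 ≤ q x) (hq1 : ∑ x, q x = 1) {n : ℕ} {T τ : ℝ} (hτ : 0 < τ) (hτ1 : τ ≤ 1)
    (hn : 625 * √(Fintype.card Ω) ≤ τ * n)
    (hacc : prob p n (fun l => ¬ Accurate p q n T l) ≤ 1 / 10)
    {A : List Ω → List Ω → List Ω → Prop}
    (hA : ∀ l a b, Accurate p q n T l →
      |twoBatchStat q (smallDev q n T l) n a b - chiSq p q (smallDev q n T l)| <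
        max (chiSq p q (smallDev q n T l)) τ / 2 → A l a b) :
    4 / 5 ≤ expect p n fun l => expect p n fun a => prob p n fun b => A l a b := by
  classical
  have hgood : ∀ l, Accurate p q n T l →
      9 / 10 ≤ expect p n fun a => prob p n fun b => A l a b := by
    intro l hl
    have h := expect_prob_twoBatchStat_le hp hp1 hq hq1 (smallDev q n T l) hτ hτ1 hn
    calc (9 / 10 : ℝ) ≤ 1 + (-1) * expect p n (fun a => prob p n fun b =>
          max (chiSq p q (smallDev q n T l)) τ / 2 ≤
            |twoBatchStat q (smallDev q n T l) n a b - chiSq p q (smallDev q n T l)|) := by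
          linarith
      _ = expect p n (fun a => prob p n fun b =>
          ¬ max (chiSq p q (smallDev q n T l)) τ / 2 ≤
            |twoBatchStat q (smallDev q n T l) n a b - chiSq p q (smallDev q n T l)|) := by
          rw [← expect_const_mul]
          nth_rw 1 [← expect_const hp1 n 1]
          rw [← expect_add]
          congr 1
          funext a
          rw [prob_not hp1]
          ring
      _ ≤ _ := expect_mono hp n fun a => prob_mono hp n fun b hb => hA l a b hl (not_le.1 hb)
  have hprob : 9 / 10 ≤ prob p n (fun l => Accurate p q n T l) := by
    rw [prob_not hp1] at hacc
    linarith
  calc (4 / 5 : ℝ) ≤ 9 / 10 * prob p n (fun l => Accurate p q n T l) := by linarith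
    _ = expect p n (fun l => 9 / 10 * if Accurate p q n T l then 1 else 0) := by
        rw [expect_const_mul, prob]
    _ ≤ _ := by
        refine expect_mono hp n fun l => ?_
        split_ifs with h
        · simpa using hgood l h
        · rw [mul_zero]
          refine expect_nonneg hp n fun a => expect_nonneg hp n fun b => ?_
          split_ifs <;> norm_num

theorem accepts_of_sum_abs_le (hq : ∀ x, 0 ≤ q x) {n : ℕ} {T ε₁ ε₂ : ℝ} (hT : 0 ≤ T)
    (hε : ε₁ ≤ ε₂ / 10) (hTε : T * ε₁ ≤ 3 * ε₂ ^ 2 / 160)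
    (hclose : ∑ x, |p x - q x| ≤ ε₁) {l a b : List Ω} (hl : Accurate p q n T l)
    (hab : |twoBatchStat q (smallDev q n T l) n a b - chiSq p q (smallDev q n T l)| <
        max (chiSq p q (smallDev q n T l)) (ε₂ ^ 2 / 16) / 2) :
    Accepts q n T ε₂ l a b := by
  have hε₁ : 0 ≤ ε₁ := (sum_nonneg fun x _ => abs_nonneg _).trans hclose
  have hD : chiSq p q (smallDev q n T l) ≤ ε₂ ^ 2 / 16 / 2 := by
    have h1 := hl.chiSq_le hq hT
    have h2 : 5 / 3 * T * ∑ x, |p x - q x| ≤ 5 / 3 * T * ε₁ := by gcongr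
    linarith
  refine ⟨?_, ?_⟩
  · have := hl.sum_abs_freq_sub_le
    linarith
  · rw [max_eq_right (by linarith [sq_nonneg ε₂])] at hab
    linarith [(abs_lt.1 hab).2]

theorem not_accepts_of_le_sum_abs [Nonempty Ω] (hq : ∀ x, 0 ≤ q x) (hq1 : ∑ x, q x = 1) {n : ℕ}
    {T ε₂ : ℝ} (hε : 0 < ε₂) (hfar : ε₂ ≤ ∑ x, |p x - q x|) {l a b : List Ω}
    (hl : Accurate p q n T l)
    (hab : |twoBatchStat q (smallDev q n T l) n a b - chiSq p q (smallDev q n T l)| <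
        max (chiSq p q (smallDev q n T l)) (ε₂ ^ 2 / 16) / 2) :
    ¬ Accepts q n T ε₂ l a b := by
  rintro ⟨h1, h2⟩
  have h3 := hl.sum_abs_sub_le
  have h4 := sum_largeDev_add_sum_smallDev q n T l fun x => |p x - q x|
  have h5 : ε₂ / 2 ≤ ∑ x ∈ smallDev q n T l, |p x - q x| := by linarith
  have h6 := sq_sum_abs_sub_le_chiSq (p := p) hq hq1 (smallDev q n T l)
  have h7 : (ε₂ / 2) ^ 2 ≤ (∑ x ∈ smallDev q n T l, |p x - q x|) ^ 2 := by gcongr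
  have h8 : ε₂ ^ 2 / 8 ≤ chiSq p q (smallDev q n T l) := by linarith
  rw [max_eq_left (by linarith [sq_nonneg ε₂])] at hab
  linarith [(abs_lt.1 hab).1]

end IdentityTester

theorem sum_toReal_eq_one {Ω : Type u} [Fintype Ω] (P : PMF Ω) : ∑ x, (P x).toReal = 1 := by
  rw [← ENNReal.toReal_sum fun x _ => PMF.apply_ne_top P x, ← tsum_fintype (L := .unconditional Ω),
    P.tsum_coe, ENNReal.toReal_one]

theorem four_fifths_le_of_toReal {r : ENNReal} (h : (4 / 5 : ℝ) ≤ r.toReal) :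
    4 / 5 ≤ r := by
  have h45 : (4 / 5 : ENNReal) = ENNReal.ofReal (4 / 5) := by
    rw [ENNReal.ofReal_div_of_pos (by norm_num)]
    simp
  rw [h45]
  exact ENNReal.ofReal_le_of_le_toReal h

end DistributionTesting

theorem theorem1 :
    ∃ c : ℝ, 0 < c ∧ ∃ (C : ℝ) (k : ℕ),
      ∀ (Ω : Type u) [Fintype Ω] [Nonempty Ω] (c₁ ε₁ ε₂ : ℝ),
        0 < c₁ → c₁ ≤ 1 → 0 < ε₂ → ε₂ ≤ 1 → 0 ≤ ε₁ →
        ε₁ ≤ c * ε₂ / (DistributionTesting.numBuckets c₁ (Fintype.card Ω) ε₂ : ℝ) →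
        ∃ (A : DistributionTesting.Tester Ω) (m : ℕ),
          A.sampleCount ≤ (m : ℕ∞) ∧
          (m : ℝ) ≤ C * (1 + Real.log ((Fintype.card Ω : ℝ) / ε₂)) ^ k *
            ((Fintype.card Ω : ℝ) * (ε₁ / ε₂ ^ 2) ^ 2 + (Fintype.card Ω : ℝ) * (ε₁ / ε₂ ^ 2) +
              Real.sqrt (Fintype.card Ω : ℝ) / ε₂ ^ 2) ∧
          ∀ Pref P : PMF Ω,
            DistributionTesting.l2Norm Pref ≤ Real.sqrt (2 / (Fintype.card Ω : ℝ)) →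
            (DistributionTesting.l1Dist P Pref ≤ ε₁ → 4 / 5 ≤ A.run P Pref true) ∧
            (ε₂ ≤ DistributionTesting.l1Dist P Pref → 4 / 5 ≤ A.run P Pref false) := by
  classical
  refine ⟨1 / 10, by norm_num, 9 * (10 ^ 6 + 1), 1, ?_⟩
  intro Ω _ _ c₁ ε₁ ε₂ _ _ hε₂ hε₂1 hε₁ hε
  have hε' : ε₁ ≤ ε₂ / 10 := by
    refine hε.trans ((div_le_self (by positivity) ?_).trans_eq (by ring))
    exact_mod_cast Nat.succ_le_succ (Nat.zero_le _)
  set N := (Fintype.card Ω : ℝ) with hN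
  have hN1 : 1 ≤ N := by
    rw [hN]
    exact_mod_cast Fintype.card_pos
  set F := N * (ε₁ / ε₂ ^ 2) ^ 2 + N * (ε₁ / ε₂ ^ 2) + √N / ε₂ ^ 2 with hF
  have hε₂2 : ε₂ ^ 2 ≤ 1 := pow_le_one₀ hε₂.le hε₂1
  have hF3 : √N / ε₂ ^ 2 ≤ F := by
    rw [hF]
    have : 0 ≤ N * (ε₁ / ε₂ ^ 2) ^ 2 + N * (ε₁ / ε₂ ^ 2) := by positivity
    linarith
  have hF1 : N * (ε₁ / ε₂ ^ 2) ^ 2 ≤ F := by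
    rw [hF]
    have : 0 ≤ N * (ε₁ / ε₂ ^ 2) + √N / ε₂ ^ 2 := by positivity
    linarith
  have hF2 : N * (ε₁ / ε₂ ^ 2) ≤ F := by
    rw [hF]
    have : 0 ≤ N * (ε₁ / ε₂ ^ 2) ^ 2 + √N / ε₂ ^ 2 := by positivity
    linarith
  have hFone : 1 ≤ F := by
    refine le_trans ?_ hF3
    rw [one_le_div (by positivity)]
    exact hε₂2.trans (Real.one_le_sqrt.2 hN1)
  set L := Real.log (20 * N) with hL
  have hL1 : 1 ≤ L := by
    rw [hL, Real.le_log_iff_exp_le (by positivity)]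
    linarith [Real.exp_one_lt_d9]
  have hLlog : L ≤ 3 * (1 + Real.log (N / ε₂)) := by
    have h20 : Real.log 20 ≤ 3 := by
      rw [Real.log_le_iff_le_exp (by norm_num)]
      have : Real.exp 3 = Real.exp 1 ^ 3 := by
        rw [← Real.exp_nat_mul]
        norm_num
      rw [this]
      calc (20 : ℝ) ≤ 2.718 ^ 3 := by norm_num
        _ ≤ Real.exp 1 ^ 3 := by
          gcongr
          linarith [Real.exp_one_gt_d9]
    have h1 : Real.log N ≤ Real.log (N / ε₂) :=
      Real.log_le_log (by positivity) (le_div_self (by positivity) hε₂ hε₂1)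
    have h2 : 0 ≤ Real.log N := Real.log_nonneg hN1
    rw [hL, Real.log_mul (by norm_num) (by positivity)]
    linarith
  -- The factor `10 ^ 6` makes `160 / 10 ^ 6 + 12 / √(10 ^ 6)`, hence `T * ε₁ / ε₂ ^ 2`, at most
  -- `3 / 160`.
  set M := ⌈10 ^ 6 * L * F⌉₊ with hM
  have hMge : 10 ^ 6 * L * F ≤ M := Nat.le_ceil _
  have hLF : 1 ≤ L * F := one_le_mul_of_one_le_of_one_le hL1 hFone
  have hM0' : (0 : ℝ) < M := by nlinarith
  have hM0 : 0 < M := by exact_mod_cast hM0'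
  have hMle : (M : ℝ) ≤ (10 ^ 6 + 1) * (L * F) := by
    have := (Nat.ceil_lt_add_one (a := 10 ^ 6 * L * F) (by positivity)).le
    rw [← hM] at this
    linarith
  -- Up to constants, `T` is the least relative resolution at which `M` samples are accurate.
  set α := L * N / M with hα
  have hα0 : 0 < α := by positivity
  set T := 160 * α + 12 * √α with hT
  have hT0 : 0 < T := by positivity
  have hMα : M * α = L * N := by
    rw [hα]
    field_simp
  have hT1 : 160 * L * N ≤ M * T := by
    calc 160 * L * N = M * (160 * α) := by linarith
      _ ≤ M * T := by
        gcongr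
        rw [hT]
        exact le_add_of_nonneg_right (by positivity)
  have hT2 : 128 * L * N ≤ M * T ^ 2 := by
    calc 128 * L * N = M * (128 * α) := by linarith
      _ ≤ M * (12 * √α) ^ 2 := by
        rw [mul_pow, Real.sq_sqrt hα0.le]
        gcongr
        norm_num
      _ ≤ M * T ^ 2 := by
        gcongr
        rw [hT]
        exact le_add_of_nonneg_left (by positivity)
  have hαε : α * ε₁ ≤ ε₂ ^ 2 / 10 ^ 6 := by
    rw [hα, div_mul_eq_mul_div, div_le_iff₀ hM0']
    calc L * N * ε₁ = ε₂ ^ 2 / 10 ^ 6 * (10 ^ 6 * L * (N * (ε₁ / ε₂ ^ 2))) := by field_simp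
      _ ≤ ε₂ ^ 2 / 10 ^ 6 * (10 ^ 6 * L * F) := by gcongr
      _ ≤ ε₂ ^ 2 / 10 ^ 6 * M := by gcongr
  have hαε2 : √α * ε₁ ≤ ε₂ ^ 2 / 10 ^ 3 := by
    refine abs_le_of_sq_le_sq' ?_ (by positivity) |>.2
    rw [mul_pow, Real.sq_sqrt hα0.le, hα, div_mul_eq_mul_div, div_le_iff₀ hM0']
    calc L * N * ε₁ ^ 2 =
          (ε₂ ^ 2 / 10 ^ 3) ^ 2 * (10 ^ 6 * L * (N * (ε₁ / ε₂ ^ 2) ^ 2)) := by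
          field_simp
      _ ≤ (ε₂ ^ 2 / 10 ^ 3) ^ 2 * (10 ^ 6 * L * F) := by gcongr
      _ ≤ (ε₂ ^ 2 / 10 ^ 3) ^ 2 * M := by gcongr
  have hTε : T * ε₁ ≤ 3 * ε₂ ^ 2 / 160 := by
    rw [hT, add_mul]
    linarith [sq_nonneg ε₂]
  have hn : 625 * √N ≤ ε₂ ^ 2 / 16 * M := by
    calc 625 * √N = ε₂ ^ 2 / 16 * (10 ^ 4 * (√N / ε₂ ^ 2)) := by
          field_simp
          norm_num
      _ ≤ ε₂ ^ 2 / 16 * (10 ^ 6 * L * F) := by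
          gcongr
          linarith
      _ ≤ ε₂ ^ 2 / 16 * M := by gcongr
  refine ⟨DistributionTesting.identityTester Ω M T ε₂, 3 * M,
    DistributionTesting.sampleCount_identityTester_le M T ε₂, ?_, ?_⟩
  · rw [pow_one]
    push_cast
    calc 3 * (M : ℝ) ≤ 3 * ((10 ^ 6 + 1) * (3 * (1 + Real.log (N / ε₂)) * F)) := by
          refine mul_le_mul_of_nonneg_left (hMle.trans ?_) (by norm_num)
          gcongr
      _ = _ := by ring
  · intro Pref P _
    have hp : ∀ x, 0 ≤ (P x).toReal := fun x => ENNReal.toReal_nonneg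
    have hq : ∀ x, 0 ≤ (Pref x).toReal := fun x => ENNReal.toReal_nonneg
    have hp1 := DistributionTesting.sum_toReal_eq_one P
    have hq1 := DistributionTesting.sum_toReal_eq_one Pref
    have hacc := DistributionTesting.prob_not_accurate_le hp hp1 hq hM0 hT0 hT1 hT2
    have hexp : 2 * N * Real.exp (-L) = 1 / 10 := by
      rw [hL, Real.exp_neg, Real.exp_log (by positivity)]
      field_simp
      norm_num
    rw [← hN, hexp] at hacc
    have hτ : 0 < ε₂ ^ 2 / 16 := by positivity
    have hτ1 : ε₂ ^ 2 / 16 ≤ 1 := by linarith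
    refine ⟨fun hclose => ?_, fun hfar => ?_⟩
    · refine DistributionTesting.four_fifths_le_of_toReal ?_
      rw [DistributionTesting.run_identityTester_true]
      exact DistributionTesting.four_fifths_le_expect hp hp1 hq hq1 hτ hτ1 hn hacc
        fun l a b hl hab =>
          DistributionTesting.accepts_of_sum_abs_le hq hT0.le hε' hTε hclose hl hab
    · refine DistributionTesting.four_fifths_le_of_toReal ?_
      rw [DistributionTesting.run_identityTester_false]
      exact DistributionTesting.four_fifths_le_expect hp hp1 hq hq1 hτ hτ1 hn hacc
        fun l a b hl hab =>
          DistributionTesting.not_accepts_of_le_sum_abs hq hq1 hε₂ hfar hl hab
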